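/- Let $V$ be a real and $W$ a complex vector space, both of finite dimension, and let $V^{\mathbb C}=V\oplus iV$ be the complexification of $V$, with $\operatorname{Im}(x+iy):=y$ for $x,y\in V$. Let $F:W\times W\to V^{\mathbb C}$ be a $V$-hermitian form, i.e. complex linear in the first variable, antilinear in the second, with $F(w,w)\in V$ for all $w\in W$, and suppose that $F$ is nondegenerate: $F(w,W)=0$ implies $w=0$. Let $C\subset V$ be a (locally closed) real-analytic submanifold, and consider the Siegel CR-submanifold $$\Sigma=\{(z,w)\in V^{\mathbb C}\oplus W:\ \operatorname{Im} z-F(w,w)\in C\}$$ of $E:=V^{\mathbb C}\oplus W$ and the associated tube $T=V+iC=\{z\in V^{\mathbb C}:\operatorname{Im}z\in C\}\subset V^{\mathbb C}$. Then: (i) $\Sigma$ is holomorphically nondegenerate if $T$ is holomorphically nondegenerate. (ii) $\Sigma$ is of finite type if $T$ is of finite type, or if the set $F(W,W)=\{F(w,w'):w,w'\in W\}$ spans the vector space $V^{\mathbb C}$. Here, for a generic real-analytic CR-submanifold $M$ of a finite-dimensional complex vector space $Z$, put $H_aM=T_aM\cap iT_aM$ for $a\in M$, and let $\mathfrak{hol}(M,a)$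 be the real Lie algebra of all germs at $a$ of holomorphic vector fields on $Z$ that are tangent to $M$ at the points of $M$ near $a$. $M$ is called holomorphically nondegenerate if $\mathfrak{hol}(M,a)\cap i\,\mathfrak{hol}(M,a)=\{0\}$ for every $a\in M$. $M$ is called of finite type if for every $a\in M$ the smooth local sections of the bundle $HM$ near $a$, together with all their iterated Lie brackets, span $T_aM$. -/

import Mathlib

open scoped Topology ContDiff ComplexConjugate

namespace SiegelCR

section Submanifolds

/-- `C ⊆ V` is a (locally closed, embedded) real-analytic submanifold: near each of its points it is
the zero set of a real-analytic submersion. -/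
def IsAnalyticSubmanifold {V : Type*} [NormedAddCommGroup V] [NormedSpace ℝ V]
    (C : Set V) : Prop :=
  ∀ a ∈ C, ∃ U : Set V, IsOpen U ∧ a ∈ U ∧ ∃ (k : ℕ) (ρ : V → (Fin k → ℝ)),
    AnalyticOnNhd ℝ ρ U ∧ (∀ x ∈ U, Function.Surjective (fderiv ℝ ρ x)) ∧
    C ∩ U = {x ∈ U | ρ x = 0}

end Submanifolds

section CR

variable {E : Type*} [NormedAddCommGroup E] [NormedSpace ℂ E]

/-- The tangent space `T_a M` of a submanifold `M` of the complex vector space `E`: all velocities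
at `a` of curves in `M` through `a`. -/
def tangentSpace (M : Set E) (a : E) : Set E :=
  {v | ∃ γ : ℝ → E, γ 0 = a ∧ (∀ᶠ t in 𝓝 (0 : ℝ), γ t ∈ M) ∧ HasDerivAt γ v 0}

/-- The holomorphic tangent space `H_a M = T_a M ∩ i T_a M`. -/
def holTangentSpace (M : Set E) (a : E) : Set E :=
  {v | v ∈ tangentSpace M a ∧ ∃ u ∈ tangentSpace M a, v = Complex.I • u}

/-- `f` represents an element of `hol(M, a)`, for a generically embedded CR-submanifold `M ⊆ E`: the
germ at `a` of a holomorphic vector field on `E` which is tangent to `M`. -/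
def IsHolGerm (M : Set E) (a : E) (f : E → E) : Prop :=
  AnalyticAt ℂ f a ∧ ∀ᶠ p in 𝓝[M] a, f p ∈ tangentSpace M p

/-- The germ `(M, a)` is holomorphically nondegenerate: with `𝔤 = hol(M, a)` one has
`𝔤 ∩ i𝔤 = {0}`, as germs at `a` of holomorphic vector fields on `E`. -/
def HolNondegenerateAt (M : Set E) (a : E) : Prop :=
  ∀ f g : E → E, IsHolGerm M a f → IsHolGerm M a g →
    f =ᶠ[𝓝 a] (fun p => Complex.I • g p) → f =ᶠ[𝓝 a] 0

/-- `M` is holomorphically nondegenerate (at every point). -/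
def HolNondegenerate (M : Set E) : Prop :=
  ∀ a ∈ M, HolNondegenerateAt M a

/-- Iterated Lie brackets (of any length `≥ 1`, with any bracketing) of smooth sections of `HM` over
`M ∩ U`. Vector fields on `M ∩ U` are represented by smooth extensions to the open set `U ⊆ E`; at
points of `M` the bracket of tangential fields does not depend on the chosen extensions. -/
inductive IsIteratedBracket (M U : Set E) : (E → E) → Prop
  | sec (X : E → E) (hX : ContDiffOn ℝ ∞ X U)
      (hXM : ∀ p ∈ M ∩ U, X p ∈ holTangentSpace M p) : IsIteratedBracket M U X
  | bracket (X Y : E → E) (hX : IsIteratedBracket M U X) (hY : IsIteratedBracket M U Y) :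
      IsIteratedBracket M U (VectorField.lieBracket ℝ X Y)

/-- `M` is of finite type at `a`: near `a`, the smooth sections of `HM` together with all their
iterated brackets span `T_a M`. (The values at `a` of these fields always lie in `T_a M`.) -/
def FiniteTypeAt (M : Set E) (a : E) : Prop :=
  ∃ U : Set E, IsOpen U ∧ a ∈ U ∧
    tangentSpace M a ⊆ Submodule.span ℝ {v : E | ∃ X, IsIteratedBracket M U X ∧ v = X a}

/-- `M` is of finite type (at every point). -/
def FiniteType (M : Set E) : Prop :=
  ∀ a ∈ M, FiniteTypeAt M a

end CR

section Siegel

variable {V VC W : Type*}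
  [NormedAddCommGroup V] [NormedSpace ℝ V]
  [NormedAddCommGroup VC] [NormedSpace ℂ VC]
  [NormedAddCommGroup W] [NormedSpace ℂ W]

/-- The imaginary part `Im : V^ℂ → V`, `x + iy ↦ y`, where `ι : V → V^ℂ` is the inclusion into the
complexification. See `imPart_apply` and `exists_re_add_im`. -/
noncomputable def imPart {ι : V →ₗ[ℝ] VC} (hι : IsBaseChange ℂ ι) : VC →ₗ[ℝ] V :=
  (TensorProduct.lid ℝ V).toLinearMap ∘ₗ (Complex.imLm.rTensor V) ∘ₗ
    (hι.equiv.symm.toLinearMap.restrictScalars ℝ)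

theorem imPart_apply {ι : V →ₗ[ℝ] VC} (hι : IsBaseChange ℂ ι) (x y : V) :
    imPart hι (ι x + Complex.I • ι y) = y := by
  have h1 : hι.equiv.symm (ι x) = TensorProduct.tmul ℝ (1 : ℂ) x := hι.equiv_symm_apply x
  have h2 : hι.equiv.symm (ι y) = TensorProduct.tmul ℝ (1 : ℂ) y := hι.equiv_symm_apply y
  simp [imPart, h1, h2, TensorProduct.smul_tmul']

theorem exists_re_add_im {ι : V →ₗ[ℝ] VC} (hι : IsBaseChange ℂ ι) (z : VC) :
    ∃ x : V, z = ι x + Complex.I • ι (imPart hι z) := by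
  suffices h : ∃ x y : V, z = ι x + Complex.I • ι y by
    obtain ⟨x, y, rfl⟩ := h
    exact ⟨x, by rw [imPart_apply]⟩
  induction z using hι.inductionOn with
  | zero => exact ⟨0, 0, by simp⟩
  | tmul m => exact ⟨m, 0, by simp⟩
  | smul c z h =>
    obtain ⟨x, y, rfl⟩ := h
    refine ⟨c.re • x - c.im • y, c.im • x + c.re • y, ?_⟩
    simp only [map_sub, map_add, map_smul]
    have hr : ∀ (r : ℝ) (v : VC), r • v = (r : ℂ) • v := fun r v => rfl
    simp only [hr]
    conv_lhs => rw [← Complex.re_add_im c]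
    have hI : Complex.I * Complex.I = -1 := Complex.I_mul_I
    match_scalars
    · ring
    · linear_combination (c.im : ℂ) * hI
  | add z₁ z₂ h₁ h₂ =>
    obtain ⟨x₁, y₁, rfl⟩ := h₁
    obtain ⟨x₂, y₂, rfl⟩ := h₂
    exact ⟨x₁ + x₂, y₁ + y₂, by simp only [map_add, smul_add]; abel⟩

/-- The tube `T = V + iC = {z ∈ V^ℂ : Im z ∈ C}` over `C`. -/
def tube {ι : V →ₗ[ℝ] VC} (hι : IsBaseChange ℂ ι) (C : Set V) : Set VC :=
  {z | imPart hι z ∈ C}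

/-- A sesquilinear map `F : W × W → V^ℂ` (complex linear in the first and antilinear in the second
variable) is `V`-hermitian if `F(w, w) ∈ V` for every `w`. -/
def IsVHermitian (ι : V →ₗ[ℝ] VC) (F : W →ₗ[ℂ] W →ₗ⋆[ℂ] VC) : Prop :=
  ∀ w, F w w ∈ LinearMap.range ι

/-- `F` is nondegenerate: `F(w, W) = 0` implies `w = 0`. -/
def IsNondegenerate (F : W →ₗ[ℂ] W →ₗ⋆[ℂ] VC) : Prop :=
  ∀ w, (∀ u, F w u = 0) → w = 0

/-- The Siegel submanifold `Σ = {(z, w) ∈ V^ℂ ⊕ W : Im z - F(w, w) ∈ C}`. -/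
def siegel {ι : V →ₗ[ℝ] VC} (hι : IsBaseChange ℂ ι) (F : W →ₗ[ℂ] W →ₗ⋆[ℂ] VC) (C : Set V) :
    Set (VC × W) :=
  {p | ι (imPart hι p.1) - F p.2 p.2 ∈ ι '' C}

end Siegel

end SiegelCR

/-! Write `s(z, w) = z - iF(w, w)`, so that `Σ = s⁻¹(T)`. Modulo `V`, which acts on `T` by
translations, the derivative of `s` at `(z, w)` is the complex linear map `v ↦ v₁ - 2iF(v₂, w)`.
This map therefore detects both `TΣ` and `HΣ` (`mem_tangentSpace_siegel`,
`mem_holTangentSpace_siegel`).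

(i) If `f` lies in `hol ∩ i hol`, then for fixed `w` the holomorphic field `f₁ - 2iF(f₂, w)`,
translated by `iF(w, w)`, takes values in `HT`, so it vanishes. Now `f₁ = 2iF(f₂, w)` is holomorphic
in `w` although `F` is antilinear there; this forces `F(f₂, ·) = 0`, hence `f₂ = 0` and `f₁ = 0`.

(ii) The fields `(2iF(u, w), u)` are sections of `HΣ`, so only vectors `(v, 0)` with `v` tangent to
`T` remain. Fields on `T` lift along `s` compatibly with brackets, which settles the case of `T` of
finite type. If `F(W, W)` spans, brackets of the horizontal fields yield `V`, while the part of `TT`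
in `iV` lifts from sections of `HT`. -/

namespace SiegelCR

/-! ### Tangent vectors as velocities of curves. -/

section Cone

variable {E : Type*} [NormedAddCommGroup E] [NormedSpace ℂ E]

theorem zero_mem_tangentSpace {M : Set E} {a : E} (ha : a ∈ M) : (0 : E) ∈ tangentSpace M a :=
  ⟨fun _ => a, rfl, Filter.Eventually.of_forall fun _ => ha, hasDerivAt_const _ _⟩

theorem neg_mem_tangentSpace {M : Set E} {a v : E} (hv : v ∈ tangentSpace M a) :
    -v ∈ tangentSpace M a := by
  obtain ⟨γ, h0, hM, hd⟩ := hv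
  refine ⟨fun t => γ (-t), by simpa using h0, ?_, ?_⟩
  · have : Filter.Tendsto (fun t : ℝ => -t) (𝓝 0) (𝓝 0) := by
      simpa using (continuous_neg (G := ℝ)).tendsto 0
    exact this.eventually hM
  · have h : HasDerivAt γ v (-(0 : ℝ)) := by simpa using hd
    simpa [Function.comp_def] using h.scomp (0 : ℝ) (hasDerivAt_neg (0 : ℝ))

theorem mem_holTangentSpace_iff {M : Set E} {a v : E} :
    v ∈ holTangentSpace M a ↔ v ∈ tangentSpace M a ∧ Complex.I • v ∈ tangentSpace M a := by
  constructor
  · rintro ⟨hv, u, hu, rfl⟩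
    refine ⟨hv, ?_⟩
    rw [smul_smul, Complex.I_mul_I, neg_one_smul]
    exact neg_mem_tangentSpace hu
  · rintro ⟨hv, hu⟩
    refine ⟨hv, _, neg_mem_tangentSpace hu, ?_⟩
    rw [smul_neg, smul_smul, Complex.I_mul_I, neg_one_smul, neg_neg]

end Cone

/-! ### Real and imaginary parts; translation invariance of tubes. -/

section Complexification

variable {V VC : Type*}
  [NormedAddCommGroup V] [NormedSpace ℝ V]
  [NormedAddCommGroup VC] [NormedSpace ℂ VC]
  {ι : V →ₗ[ℝ] VC}

theorem finiteDimensional_of_isBaseChange [FiniteDimensional ℝ V] (hι : IsBaseChange ℂ ι) :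
    FiniteDimensional ℂ VC :=
  Module.Finite.equiv hι.equiv

@[simp]
theorem imPart_inclusion (hι : IsBaseChange ℂ ι) (x : V) : imPart hι (ι x) = 0 := by
  simpa using imPart_apply hι x 0

@[simp]
theorem imPart_I_smul_inclusion (hι : IsBaseChange ℂ ι) (x : V) :
    imPart hι (Complex.I • ι x) = x := by
  simpa using imPart_apply hι 0 x

/-- The decomposition into real and imaginary parts, the real part being `Im (i z)`. -/
theorem re_add_im (hι : IsBaseChange ℂ ι) (z : VC) :
    z = ι (imPart hι (Complex.I • z)) + Complex.I • ι (imPart hι z) := by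
  obtain ⟨x, hx⟩ := exists_re_add_im hι z
  have h : imPart hι (Complex.I • z) = x := by
    rw [hx, smul_add, smul_smul, Complex.I_mul_I, neg_one_smul, map_add, map_neg]
    simp
  rw [h]
  exact hx

theorem eq_inclusion_of_imPart_eq_zero (hι : IsBaseChange ℂ ι) {z : VC} (hz : imPart hι z = 0) :
    ι (imPart hι (Complex.I • z)) = z := by
  have h := re_add_im hι z
  rw [hz, map_zero, smul_zero, add_zero] at h
  exact h.symm

theorem inclusion_injective (hι : IsBaseChange ℂ ι) : Function.Injective ι := fun x y h => by
  rw [← imPart_I_smul_inclusion hι x, h, imPart_I_smul_inclusion]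

/-- Tubes are invariant under real translations, hence so are their tangent spaces. -/
theorem tangentSpace_tube_add_inclusion (hι : IsBaseChange ℂ ι) {C : Set V} {z v : VC}
    (hv : v ∈ tangentSpace (tube hι C) z) (x : V) : v + ι x ∈ tangentSpace (tube hι C) z := by
  obtain ⟨γ, h0, hM, hd⟩ := hv
  refine ⟨fun t => γ t + t • ι x, by simpa using h0, ?_, ?_⟩
  · filter_upwards [hM] with t ht
    rwa [tube, Set.mem_ofPred_eq, map_add, map_smul, imPart_inclusion, smul_zero, add_zero]
  · simpa using hd.fun_add ((hasDerivAt_id (0 : ℝ)).smul_const (ι x))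

theorem tangentSpace_tube_add (hι : IsBaseChange ℂ ι) {C : Set V} {z v r : VC}
    (hr : imPart hι r = 0) :
    v + r ∈ tangentSpace (tube hι C) z ↔ v ∈ tangentSpace (tube hι C) z := by
  have h := eq_inclusion_of_imPart_eq_zero hι hr
  constructor
  · intro hv
    have := tangentSpace_tube_add_inclusion hι hv (-imPart hι (Complex.I • r))
    rwa [map_neg, h, add_neg_cancel_right] at this
  · intro hv
    rw [← h]
    exact tangentSpace_tube_add_inclusion hι hv _

end Complexification

/-! ### The hermitian form and the tangent spaces of the Siegel submanifold. -/

section Form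

variable {V VC W : Type*}
  [NormedAddCommGroup V] [NormedSpace ℝ V]
  [NormedAddCommGroup VC] [NormedSpace ℂ VC]
  [NormedAddCommGroup W] [NormedSpace ℂ W]
  {ι : V →ₗ[ℝ] VC}

theorem imPart_form_self (hι : IsBaseChange ℂ ι) {F : W →ₗ[ℂ] W →ₗ⋆[ℂ] VC}
    (hF : IsVHermitian ι F) (w : W) : imPart hι (F w w) = 0 := by
  obtain ⟨x, hx⟩ := hF w
  rw [← hx, imPart_inclusion]

/-- Polarization of `Im F(w, w) = 0`. With the next lemma it says that `F(w, u)` and `F(u, w)` are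
conjugate. -/
theorem imPart_form_swap (hι : IsBaseChange ℂ ι) {F : W →ₗ[ℂ] W →ₗ⋆[ℂ] VC}
    (hF : IsVHermitian ι F) (u w : W) : imPart hι (F w u) = -imPart hι (F u w) := by
  have h := imPart_form_self hι hF (u + w)
  simp only [map_add, LinearMap.add_apply, imPart_form_self hι hF] at h
  rw [eq_neg_iff_add_eq_zero]
  simpa using h

theorem imPart_I_smul_form_swap (hι : IsBaseChange ℂ ι) {F : W →ₗ[ℂ] W →ₗ⋆[ℂ] VC}
    (hF : IsVHermitian ι F) (u w : W) :
    imPart hι (Complex.I • F w u) = imPart hι (Complex.I • F u w) := by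
  have h := imPart_form_swap hι hF u (Complex.I • w)
  simpa using h

/-- The form `F` as a continuous real bilinear map. -/
noncomputable def realForm [FiniteDimensional ℂ W] (F : W →ₗ[ℂ] W →ₗ⋆[ℂ] VC) :
    W →L[ℝ] W →L[ℝ] VC :=
  haveI : FiniteDimensional ℝ W := FiniteDimensional.complexToReal W
  (LinearMap.mk₂ ℝ (fun u w => F u w) (by simp)
    (by simp)
    (by simp)
    (fun c u w => by simpa using (F u).map_smulₛₗ (c : ℂ) w)).toContinuousBilinearMap

@[simp]
theorem realForm_apply [FiniteDimensional ℂ W] (F : W →ₗ[ℂ] W →ₗ⋆[ℂ] VC) (u w : W) :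
    realForm F u w = F u w := rfl

/-- The map `(z, w) ↦ z - i F(w, w)`, under which the Siegel submanifold is the preimage of the
tube. -/
noncomputable def shift (F : W →ₗ[ℂ] W →ₗ⋆[ℂ] VC) (p : VC × W) : VC :=
  p.1 - Complex.I • F p.2 p.2

theorem mem_siegel_iff (hι : IsBaseChange ℂ ι) {F : W →ₗ[ℂ] W →ₗ⋆[ℂ] VC}
    (hF : IsVHermitian ι F) {C : Set V} {p : VC × W} :
    p ∈ siegel hι F C ↔ shift F p ∈ tube hι C := by
  have h : ι (imPart hι p.1) - F p.2 p.2 = ι (imPart hι (shift F p)) := by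
    conv_lhs => rw [← eq_inclusion_of_imPart_eq_zero hι (imPart_form_self hι hF p.2)]
    rw [shift, ← map_sub, ← map_sub]
  rw [siegel, Set.mem_ofPred_eq, h, (inclusion_injective hι).mem_set_image]
  rfl

/-- The derivative of `shift F` at `p`. -/
noncomputable def shiftDeriv [FiniteDimensional ℂ W] (F : W →ₗ[ℂ] W →ₗ⋆[ℂ] VC) (p : VC × W) :
    VC × W →L[ℝ] VC :=
  ContinuousLinearMap.fst ℝ VC W - Complex.I •
    (((realForm F p.2) + (realForm F).flip p.2).comp (ContinuousLinearMap.snd ℝ VC W))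

theorem shiftDeriv_apply [FiniteDimensional ℂ W] (F : W →ₗ[ℂ] W →ₗ⋆[ℂ] VC) (p v : VC × W) :
    shiftDeriv F p v = v.1 - Complex.I • (F p.2 v.2 + F v.2 p.2) := by
  simp [shiftDeriv]

theorem hasFDerivAt_shift [FiniteDimensional ℂ W] (F : W →ₗ[ℂ] W →ₗ⋆[ℂ] VC) (p : VC × W) :
    HasFDerivAt (shift F) (shiftDeriv F p) p := by
  have h := (hasFDerivAt_fst (𝕜 := ℝ) (p := p)).sub
    (((realForm F).hasFDerivAt_of_bilinear (hasFDerivAt_snd (𝕜 := ℝ) (p := p))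
      (hasFDerivAt_snd (𝕜 := ℝ) (p := p))).const_smul Complex.I)
  refine h.congr_fderiv ?_
  ext v <;> simp [shiftDeriv_apply]

theorem contDiff_shift [FiniteDimensional ℂ W] (F : W →ₗ[ℂ] W →ₗ⋆[ℂ] VC) :
    ContDiff ℝ ∞ (shift F) := by
  have h : ContDiff ℝ ∞ fun p : VC × W => realForm F p.2 p.2 :=
    ((realForm F).contDiff.comp contDiff_snd).clm_apply contDiff_snd
  exact contDiff_fst.sub (h.const_smul Complex.I)

theorem hasDerivAt_form_self [FiniteDimensional ℂ W] (F : W →ₗ[ℂ] W →ₗ⋆[ℂ] VC) {c : ℝ → W}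
    {t : ℝ} {u : W} (hc : HasDerivAt c u t) :
    HasDerivAt (fun s => F (c s) (c s)) (F (c t) u + F u (c t)) t := by
  have h := ((realForm F).hasFDerivAt_of_bilinear hc.hasFDerivAt hc.hasFDerivAt).hasDerivAt
  simpa using h

/-- Tangent vectors of the Siegel submanifold, in terms of those of the tube. -/
theorem mem_tangentSpace_siegel [FiniteDimensional ℂ W] (hι : IsBaseChange ℂ ι)
    {F : W →ₗ[ℂ] W →ₗ⋆[ℂ] VC} (hF : IsVHermitian ι F) {C : Set V} {p v : VC × W} :
    v ∈ tangentSpace (siegel hι F C) p ↔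
      v.1 - (2 * Complex.I) • F v.2 p.2 ∈ tangentSpace (tube hι C) (shift F p) := by
  -- The derivative of `shift F` and the complex linear expression differ by a real vector, which
  -- does not affect tangency to the tube.
  have hr : imPart hι (Complex.I • (F v.2 p.2 - F p.2 v.2)) = 0 := by
    rw [smul_sub, map_sub, imPart_I_smul_form_swap hι hF, sub_self]
  have hd : v.1 - Complex.I • (F p.2 v.2 + F v.2 p.2) =
      v.1 - (2 * Complex.I) • F v.2 p.2 + Complex.I • (F v.2 p.2 - F p.2 v.2) := by
    module
  rw [← tangentSpace_tube_add hι hr, ← hd]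
  constructor
  · rintro ⟨γ, h0, hM, hγ⟩
    refine ⟨fun t => shift F (γ t), by simp only [h0], ?_, ?_⟩
    · filter_upwards [hM] with t ht using (mem_siegel_iff hι hF).1 ht
    · have h := (hasFDerivAt_shift F (γ 0)).comp_hasDerivAt (0 : ℝ) hγ
      rw [shiftDeriv_apply, h0] at h
      exact h
  · rintro ⟨γ, h0, hM, hγ⟩
    -- A curve in the tube is lifted over the straight line through `p.2` with velocity `v.2`.
    have hw : HasDerivAt (fun t : ℝ => p.2 + t • v.2) v.2 0 := by
      simpa using ((hasDerivAt_id (0 : ℝ)).smul_const v.2).const_add p.2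
    refine ⟨fun t => (γ t + Complex.I • F (p.2 + t • v.2) (p.2 + t • v.2), p.2 + t • v.2),
      by simp [h0, shift], ?_, ?_⟩
    · filter_upwards [hM] with t ht
      rw [mem_siegel_iff hι hF]
      simpa only [shift, add_sub_cancel_right] using ht
    · have h := (hγ.add ((hasDerivAt_form_self F hw).const_smul Complex.I)).prodMk hw
      simpa using h

/-- The tangency criterion is complex linear in `v`, so it passes to `v` and `iv` simultaneously. -/
theorem mem_holTangentSpace_siegel [FiniteDimensional ℂ W] (hι : IsBaseChange ℂ ι)
    {F : W →ₗ[ℂ] W →ₗ⋆[ℂ] VC} (hF : IsVHermitian ι F) {C : Set V} {p v : VC × W} :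
    v ∈ holTangentSpace (siegel hι F C) p ↔
      v.1 - (2 * Complex.I) • F v.2 p.2 ∈ holTangentSpace (tube hι C) (shift F p) := by
  rw [mem_holTangentSpace_iff, mem_holTangentSpace_iff, mem_tangentSpace_siegel hι hF,
    mem_tangentSpace_siegel hι hF]
  have h : (Complex.I • v).1 - (2 * Complex.I) • F (Complex.I • v).2 p.2 =
      Complex.I • (v.1 - (2 * Complex.I) • F v.2 p.2) := by
    simp only [Prod.smul_fst, Prod.smul_snd, map_smul, LinearMap.smul_apply]
    module
  rw [h]

end Form

/-! ### Holomorphic nondegeneracy. -/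

section Nondegenerate

variable {V VC W : Type*}
  [NormedAddCommGroup V] [NormedSpace ℝ V]
  [NormedAddCommGroup VC] [NormedSpace ℂ VC]
  [NormedAddCommGroup W] [NormedSpace ℂ W] [FiniteDimensional ℂ W]
  {ι : V →ₗ[ℝ] VC}

/-- A holomorphic map of the form `(z, w) ↦ c F(g(z, w), w)` with `g` holomorphic vanishes: it is
antiholomorphic along `w` up to holomorphic factors. -/
theorem eq_zero_of_eventuallyEq_form {F : W →ₗ[ℂ] W →ₗ⋆[ℂ] VC} (hFnd : IsNondegenerate F)
    {f : VC × W → VC} {g : VC × W → W} {p : VC × W} {c : ℂ} (hc : c ≠ 0)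
    (hf : DifferentiableAt ℂ f p) (hg : DifferentiableAt ℂ g p)
    (h : f =ᶠ[𝓝 p] fun q => c • F (g q) q.2) : g p = 0 := by
  apply hFnd
  intro u
  have h1 := hf.hasFDerivAt.restrictScalars ℝ
  have h2 := ((realForm F).hasFDerivAt_of_bilinear (hg.hasFDerivAt.restrictScalars ℝ)
    (hasFDerivAt_snd (𝕜 := ℝ) (p := p))).const_smul c
  have h3 := h1.unique (h2.congr_of_eventuallyEq h)
  -- Compare the real derivatives along `u` and `iu`: the terms from `f` and `g` are complex linear
  -- and cancel, while the antilinear slot leaves a multiple of `F (g p) u`.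
  have e1 := congrArg (fun l => l ((0 : VC), u)) h3
  have e2 := congrArg (fun l => l ((0 : VC), Complex.I • u)) h3
  have hs : ((0 : VC), Complex.I • u) = Complex.I • ((0 : VC), u) := by simp
  rw [ContinuousLinearMap.coe_restrictScalars', hs, map_smul] at e2
  rw [ContinuousLinearMap.coe_restrictScalars'] at e1
  rw [e1, ← hs] at e2
  have hs2 : fderiv ℂ g p ((0 : VC), Complex.I • u) = Complex.I • fderiv ℂ g p ((0 : VC), u) := by
    rw [hs, map_smul]
  simp [smul_add, hs2] at e2
  have e3 : (2 * Complex.I * c) • F (g p) u = 0 := by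
    rw [← sub_eq_zero] at e2
    rw [← e2]
    module
  simpa [hc] using e3

theorem holNondegenerate_siegel (hι : IsBaseChange ℂ ι) {F : W →ₗ[ℂ] W →ₗ⋆[ℂ] VC}
    (hF : IsVHermitian ι F) (hFnd : IsNondegenerate F) [FiniteDimensional ℝ V] {C : Set V}
    (hT : HolNondegenerate (tube hι C)) : HolNondegenerate (siegel hι F C) := by
  have := finiteDimensional_of_isBaseChange hι
  have : CompleteSpace VC := FiniteDimensional.complete ℂ VC
  have : CompleteSpace W := FiniteDimensional.complete ℂ W
  rintro ⟨z₀, w₀⟩ ha f g ⟨hfa, hfM⟩ ⟨-, hgM⟩ hfg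
  -- near the base point, `f` takes values in the holomorphic tangent spaces
  have hhol : ∀ᶠ p in 𝓝 (z₀, w₀), p ∈ siegel hι F C → f p ∈ holTangentSpace (siegel hι F C) p := by
    rw [eventually_nhdsWithin_iff] at hfM hgM
    filter_upwards [hfM, hgM, hfg] with p h1 h2 h3 hp
    exact ⟨h1 hp, g p, h2 hp, h3⟩
  obtain ⟨r, hr, hball⟩ := Metric.eventually_nhds_iff_ball.1 (hhol.and hfa.eventually_analyticAt)
  have hmem : ∀ {z w}, z ∈ Metric.ball z₀ r → w ∈ Metric.ball w₀ r →
      (z, w) ∈ Metric.ball (z₀, w₀) r := fun hz hw => by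
    rw [← ball_prod_same]
    exact ⟨hz, hw⟩
  have hQ : Continuous fun w => F w w :=
    ((realForm F).continuous.clm_apply continuous_id :)
  -- the combination of the components of `f` tangent to translates of the tube
  have key : ∀ᶠ w in 𝓝 w₀, ∀ z ∈ Metric.ball z₀ r,
      (f (z, w)).1 - (2 * Complex.I) • F (f (z, w)).2 w = 0 := by
    -- For `w` near `w₀` the translate `z₁ + iF(w, w)` of the base point of the tube stays in the
    -- fixed ball, so the identity theorem gives vanishing on that ball for all such `w`.
    have hcont : Filter.Tendsto (fun w => z₀ - Complex.I • F w₀ w₀ + Complex.I • F w w) (𝓝 w₀)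
        (𝓝 z₀) := by
      have : Continuous fun w => z₀ - Complex.I • F w₀ w₀ + Complex.I • F w w :=
        continuous_const.add (hQ.const_smul Complex.I)
      simpa using this.tendsto w₀
    filter_upwards [Metric.ball_mem_nhds w₀ hr, hcont (Metric.ball_mem_nhds z₀ hr)] with w hw hzw
    set z₁ := z₀ - Complex.I • F w₀ w₀
    set h : VC → VC := fun z => (f (z, w)).1 - (2 * Complex.I) • F (f (z, w)).2 w with hh
    have hana : AnalyticOnNhd ℂ h (Metric.ball z₀ r) := by
      intro z hz
      have h1 : AnalyticAt ℂ (fun z => f (z, w)) z :=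
        AnalyticAt.fun_comp (f := fun z => (z, w)) (hball _ (hmem hz hw)).2
          (analyticAt_id.prod analyticAt_const)
      have h2 : AnalyticAt ℂ (fun z => F (f (z, w)).2 w) z :=
        ((LinearMap.toContinuousLinearMap (F.flip w)).analyticAt _).fun_comp
          (analyticAt_snd.fun_comp h1)
      exact (analyticAt_fst.fun_comp h1).sub (h2.const_smul (c := 2 * Complex.I))
    have hz₁ : z₁ ∈ tube hι C := (mem_siegel_iff hι hF).1 ha
    have htr : Filter.Tendsto (fun z => z + Complex.I • F w w) (𝓝 z₁)
        (𝓝 (z₁ + Complex.I • F w w)) :=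
      (continuous_id.add continuous_const).tendsto z₁
    have hk : AnalyticAt ℂ (fun z => h (z + Complex.I • F w w)) z₁ :=
      AnalyticAt.fun_comp (f := fun z => z + Complex.I • F w w) (hana _ hzw)
        (analyticAt_id.fun_add analyticAt_const)
    have hkT : ∀ᶠ z in 𝓝[tube hι C] z₁,
        h (z + Complex.I • F w w) ∈ holTangentSpace (tube hι C) z := by
      rw [eventually_nhdsWithin_iff]
      filter_upwards [htr (Metric.isOpen_ball.mem_nhds hzw)] with z hz hzT
      have hs : shift F (z + Complex.I • F w w, w) = z := by simp [shift]
      have := (mem_holTangentSpace_siegel hι hF).1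
        ((hball _ (hmem hz hw)).1 ((mem_siegel_iff hι hF).2 (by rwa [hs])))
      rwa [hs] at this
    -- The second field is `-i` times the first; both are tangent because the first takes values in
    -- `HT`.
    have hzero := hT z₁ hz₁ (fun z => h (z + Complex.I • F w w))
      (fun z => -(Complex.I • h (z + Complex.I • F w w))) ⟨hk, ?_⟩ ⟨?_, ?_⟩ ?_
    · have htr' : Filter.Tendsto (fun z => z - Complex.I • F w w)
          (𝓝 (z₁ + Complex.I • F w w)) (𝓝 z₁) := by
        have : Continuous fun z : VC => z - Complex.I • F w w := by fun_prop
        simpa using this.tendsto (z₁ + Complex.I • F w w)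
      have h0 : h =ᶠ[𝓝 (z₁ + Complex.I • F w w)] 0 := by
        filter_upwards [htr' hzero] with z hz
        simpa using hz
      exact hana.eqOn_zero_of_preconnected_of_eventuallyEq_zero
        (Metric.isPreconnected_ball) hzw h0
    · filter_upwards [hkT] with z hz using hz.1
    · exact (hk.const_smul (c := Complex.I)).neg
    · filter_upwards [hkT] with z hz using neg_mem_tangentSpace (mem_holTangentSpace_iff.1 hz).2
    · refine Filter.Eventually.of_forall fun z => ?_
      simp only [smul_neg, smul_smul, Complex.I_mul_I, neg_one_smul, neg_neg]
  have hnear : ∀ᶠ p in 𝓝 (z₀, w₀), (f p).1 = (2 * Complex.I) • F (f p).2 p.2 := by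
    filter_upwards [continuous_snd.tendsto (z₀, w₀) key,
      continuous_fst.tendsto (z₀, w₀) (Metric.ball_mem_nhds z₀ hr)] with p hp hz
    exact sub_eq_zero.1 (hp p.1 hz)
  filter_upwards [hnear.eventually_nhds, hfa.eventually_analyticAt] with p hp hfp
  have h2 : (f p).2 = 0 :=
    eq_zero_of_eventuallyEq_form hFnd (f := fun q => (f q).1) (g := fun q => (f q).2)
      (c := 2 * Complex.I) (by simp) hfp.differentiableAt.fst hfp.differentiableAt.snd hp
  have h1 := hp.self_of_nhds
  rw [h2, map_zero, LinearMap.zero_apply, smul_zero] at h1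
  exact Prod.ext h1 h2

end Nondegenerate

/-! ### Curves and vector fields tangent to the fibres of a submersion. -/

section LevelSet

variable {V G : Type*}
  [NormedAddCommGroup V] [NormedSpace ℝ V]
  [NormedAddCommGroup G] [NormedSpace ℝ G] [FiniteDimensional ℝ G]

/-- Every vector in the kernel of the derivative of a submersion is the velocity of a curve in the
fibre. -/
theorem exists_curve_in_fibre [FiniteDimensional ℝ V] {ρ : V → G} {ρ' : V →L[ℝ] G} {c y : V}
    (hρ : HasStrictFDerivAt ρ ρ' c) (hs : Function.Surjective ρ') (hy : ρ' y = 0) :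
    ∃ γ : ℝ → V, γ 0 = c ∧ (∀ᶠ t in 𝓝 (0 : ℝ), ρ (γ t) = ρ c) ∧ HasDerivAt γ y 0 := by
  have : CompleteSpace V := FiniteDimensional.complete ℝ V
  have hr : ρ'.range = ⊤ := LinearMap.range_eq_top.2 hs
  let k : ρ'.ker := ⟨y, hy⟩
  refine ⟨fun t => hρ.implicitFunction ρ ρ' hr (ρ c) (t • k), by simp, ?_, ?_⟩
  · have ht : Filter.Tendsto (fun t : ℝ => (ρ c, t • k)) (𝓝 0) (𝓝 (ρ c, 0)) := by
      have : Continuous fun t : ℝ => (ρ c, t • k) := by fun_prop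
      simpa using this.tendsto 0
    exact ht (hρ.map_implicitFunction_eq hr)
  · have h1 : HasDerivAt (fun t : ℝ => t • k) k 0 := by
      simpa using (hasDerivAt_id (0 : ℝ)).smul_const k
    have h2 := (hρ.to_implicitFunction hr).hasFDerivAt
    rw [← zero_smul ℝ k] at h2
    exact h2.comp_hasDerivAt (0 : ℝ) h1

/-- Vectors in the kernel of the derivative of a smooth submersion extend to smooth fields of such
vectors, on a common neighbourhood. -/
theorem exists_smooth_kernel_section {U : Set V} (hU : IsOpen U) {A : V → V →L[ℝ] G}
    (hA : ContDiffOn ℝ ∞ A U) {c : V} (hc : c ∈ U) (hs : Function.Surjective (A c)) :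
    ∃ U' ⊆ U, IsOpen U' ∧ c ∈ U' ∧ ∀ y, A c y = 0 →
      ∃ Y : V → V, ContDiffOn ℝ ∞ Y U' ∧ Y c = y ∧ ∀ x ∈ U', A x (Y x) = 0 := by
  have : CompleteSpace G := FiniteDimensional.complete ℝ G
  obtain ⟨R, hR⟩ := (A c).exists_rightInverse_of_surjective (LinearMap.range_eq_top.2 hs)
  -- Where `A x ∘ R` is invertible, `y - R (A x ∘ R)⁻¹ (A x y)` projects `y` to the kernel of `A x`;
  -- this neighbourhood does not depend on `y`.
  let N : V → G →L[ℝ] G := fun x => (A x).comp R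
  have hN : ContDiffOn ℝ ∞ N U := hA.clm_comp contDiffOn_const
  have hopen : IsOpen (U ∩ N ⁻¹' {T | IsUnit T}) := hN.continuousOn.isOpen_inter_preimage hU
    Units.isOpen
  refine ⟨_, Set.inter_subset_left, hopen, ⟨hc, ?_⟩, fun y hy =>
    ⟨fun x => y - R (Ring.inverse (N x) (A x y)), ?_, ?_, ?_⟩⟩
  · change IsUnit ((A c).comp R)
    rw [hR]
    exact isUnit_one
  · have hinv : ContDiffOn ℝ ∞ (fun x => Ring.inverse (N x)) (U ∩ N ⁻¹' {T | IsUnit T}) := by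
      rintro x ⟨hx, T, hT⟩
      have h := contDiffAt_ringInverse ℝ (n := ∞) T
      rw [hT] at h
      exact h.comp_contDiffWithinAt x ((hN x hx).mono Set.inter_subset_left)
    exact contDiffOn_const.sub (R.contDiff.comp_contDiffOn
      (hinv.clm_apply ((hA.mono Set.inter_subset_left).clm_apply contDiffOn_const)))
  · simp [hy]
  · rintro x ⟨-, hx⟩
    have h := congrArg (fun T => T (A x y)) (Ring.mul_inverse_cancel (N x) hx)
    have h' : A x (R (Ring.inverse (N x) (A x y))) = A x y := h
    rw [map_sub, h', sub_self]

end LevelSet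

/-! ### Smoothness of iterated brackets. -/

section IteratedBrackets

variable {E : Type*} [NormedAddCommGroup E] [NormedSpace ℂ E]

theorem IsIteratedBracket.contDiffOn {M U : Set E} (hU : IsOpen U) {X : E → E}
    (hX : IsIteratedBracket M U X) : ContDiffOn ℝ ∞ X U := by
  induction hX with
  | sec X hX _ => exact hX
  | bracket X Y _ _ hX hY =>
    exact (hX.lieBracketWithin_vectorField hY hU.uniqueDiffOn (m := ∞) (by simp)).congr
      fun x hx => (VectorField.lieBracketWithin_of_isOpen hU hx).symm

theorem IsIteratedBracket.apply_mem_span {M U : Set E} {X : E → E} (hX : IsIteratedBracket M U X)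
    (a : E) : X a ∈ Submodule.span ℝ {v | ∃ X, IsIteratedBracket M U X ∧ v = X a} :=
  Submodule.subset_span ⟨X, hX, rfl⟩

end IteratedBrackets

/-! ### Finite type. -/

section FiniteType

variable {V VC W : Type*}
  [NormedAddCommGroup V] [NormedSpace ℝ V]
  [NormedAddCommGroup VC] [NormedSpace ℂ VC]
  [NormedAddCommGroup W] [NormedSpace ℂ W] [FiniteDimensional ℂ W]
  {ι : V →ₗ[ℝ] VC}

/-- The imaginary parts of tangent vectors of the tube over an analytic submanifold extend locally
to smooth sections of the holomorphic tangent bundle of the tube. -/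
theorem exists_isIteratedBracket_tube [FiniteDimensional ℝ V] (hι : IsBaseChange ℂ ι) {C : Set V}
    (hC : IsAnalyticSubmanifold C) {z : VC} (hz : z ∈ tube hι C) :
    ∃ U, IsOpen U ∧ z ∈ U ∧ ∀ v ∈ tangentSpace (tube hι C) z,
      ∃ X, IsIteratedBracket (tube hι C) U X ∧ X z = Complex.I • ι (imPart hι v) := by
  have := finiteDimensional_of_isBaseChange hι
  have : FiniteDimensional ℝ VC := FiniteDimensional.complexToReal VC
  have : CompleteSpace V := FiniteDimensional.complete ℝ V
  obtain ⟨U, hU, hzU, k, ρ, hρ, hsurj, hCU⟩ := hC _ hz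
  let J : VC →L[ℝ] V := LinearMap.toContinuousLinearMap (imPart hι)
  let K : V →L[ℝ] VC := LinearMap.toContinuousLinearMap ι
  have hK : ∀ x, K x = ι x := fun _ => rfl
  have hzero : ∀ x ∈ U, (x ∈ C ↔ ρ x = 0) := fun x hx => by
    have h : x ∈ C ∩ U ↔ x ∈ {x ∈ U | ρ x = 0} := by rw [hCU]
    simpa [hx] using h
  have hker : ∀ v ∈ tangentSpace (tube hι C) z, fderiv ℝ ρ (J z) (J v) = 0 := by
    intro v hv
    obtain ⟨γ, h0, hM, hγ⟩ := hv
    have h1 : HasDerivAt (fun t => J (γ t)) (J v) 0 := J.hasFDerivAt.comp_hasDerivAt (0 : ℝ) hγ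
    have hρ' : HasFDerivAt ρ (fderiv ℝ ρ (J (γ 0))) (J (γ 0)) := by
      rw [h0]
      exact (hρ _ hzU).differentiableAt.hasFDerivAt
    have h2 := hρ'.comp_hasDerivAt (0 : ℝ) h1
    have hcU : ∀ᶠ t in 𝓝 (0 : ℝ), J (γ t) ∈ U :=
      h1.continuousAt.eventually (hU.mem_nhds (by simpa only [h0] using! hzU))
    have h3 : (fun t => ρ (J (γ t))) =ᶠ[𝓝 0] fun _ => 0 := by
      filter_upwards [hM, hcU] with t ht htU using (hzero _ htU).1 ht
    have h4 := (h2.congr_of_eventuallyEq h3.symm).unique (hasDerivAt_const (0 : ℝ) _)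
    rwa [h0] at h4
  have hA : ContDiffOn ℝ ∞ (fderiv ℝ ρ) U := hρ.fderiv.contDiffOn hU.uniqueDiffOn
  obtain ⟨U', hU'U, hU', hzU', hsec⟩ :=
    exists_smooth_kernel_section hU hA hzU (hsurj _ hzU)
  refine ⟨J ⁻¹' U', hU'.preimage J.continuous, hzU', fun v hv => ?_⟩
  obtain ⟨Y, hY, hYz, hYk⟩ := hsec _ (hker v hv)
  -- With `Y` tangent to `C`, the field `iY(Im x)` is tangent to the tube, and multiplication by `i`
  -- makes it real, hence again tangent.
  refine ⟨fun x => Complex.I • K (Y (J x)), .sec _ ?_ ?_, congrArg (Complex.I • K ·) hYz⟩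
  · exact (K.contDiff.comp_contDiffOn
      (hY.comp J.contDiff.contDiffOn (Set.mapsTo_preimage _ _))).const_smul Complex.I
  · rintro p ⟨hp, hpU⟩
    have hpU' : J p ∈ U := hU'U hpU
    rw [mem_holTangentSpace_iff]
    constructor
    · obtain ⟨γ, h0, hM, hγ⟩ := exists_curve_in_fibre ((hρ _ hpU').hasStrictFDerivAt)
        (hsurj _ hpU') (hYk _ hpU)
      refine ⟨fun t => ι (imPart hι (Complex.I • p)) + Complex.I • K (γ t), ?_, ?_, ?_⟩
      · simp only [h0]
        exact (re_add_im hι p).symm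
      · have hγU : ∀ᶠ t in 𝓝 (0 : ℝ), γ t ∈ U :=
          hγ.continuousAt.eventually (hU.mem_nhds (by rwa [h0]))
        filter_upwards [hM, hγU] with t ht htU
        rw [tube, Set.mem_ofPred_eq, hK, imPart_apply, hzero _ htU, ht, ← hzero _ hpU']
        exact hp
      · exact ((K.hasFDerivAt.comp_hasDerivAt (0 : ℝ) hγ).const_smul Complex.I).const_add _
    · have h := tangentSpace_tube_add_inclusion hι (zero_mem_tangentSpace hp) (-Y (J p))
      rw [smul_smul, Complex.I_mul_I, neg_one_smul, hK]
      simpa using h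

/-- The lift of a vector field on `V^ℂ` to `V^ℂ ⊕ W` along `shift F`. -/
noncomputable def liftField (F : W →ₗ[ℂ] W →ₗ⋆[ℂ] VC) (X : VC → VC) (p : VC × W) : VC × W :=
  (X (shift F p), 0)

theorem hasFDerivAt_liftField (F : W →ₗ[ℂ] W →ₗ⋆[ℂ] VC) {X : VC → VC} {p : VC × W}
    (hX : DifferentiableAt ℝ X (shift F p)) :
    HasFDerivAt (liftField F X)
      (((fderiv ℝ X (shift F p)).comp (shiftDeriv F p)).prod (0 : VC × W →L[ℝ] W)) p :=
  (hX.hasFDerivAt.comp p (hasFDerivAt_shift F p)).prodMk (hasFDerivAt_const _ _)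

/-- The derivative of `shift F` is the identity on vectors `(v, 0)`, so lifting commutes with
brackets. -/
theorem lieBracket_liftField (F : W →ₗ[ℂ] W →ₗ⋆[ℂ] VC) {X Y : VC → VC} {p : VC × W}
    (hX : DifferentiableAt ℝ X (shift F p)) (hY : DifferentiableAt ℝ Y (shift F p)) :
    VectorField.lieBracket ℝ (liftField F X) (liftField F Y) p =
      liftField F (VectorField.lieBracket ℝ X Y) p := by
  simp [VectorField.lieBracket, (hasFDerivAt_liftField F hX).fderiv,
    (hasFDerivAt_liftField F hY).fderiv, liftField, shiftDeriv_apply]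

/-- Agreement with the lift is claimed only over `U`, where the fields are smooth and the bracket
formula holds. -/
theorem exists_isIteratedBracket_lift (hι : IsBaseChange ℂ ι) {F : W →ₗ[ℂ] W →ₗ⋆[ℂ] VC}
    (hF : IsVHermitian ι F) {C : Set V} {U : Set VC} (hU : IsOpen U) {X : VC → VC}
    (hX : IsIteratedBracket (tube hι C) U X) :
    ∃ Y, IsIteratedBracket (siegel hι F C) (shift F ⁻¹' U) Y ∧
      Set.EqOn Y (liftField F X) (shift F ⁻¹' U) := by
  have hU' : IsOpen (shift F ⁻¹' U) := hU.preimage (contDiff_shift F).continuous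
  induction hX with
  | sec X hX hXM =>
    refine ⟨liftField F X, .sec _ ?_ ?_, fun _ _ => rfl⟩
    · exact (hX.comp (contDiff_shift F).contDiffOn (Set.mapsTo_preimage _ _)).prodMk
        contDiffOn_const
    · rintro p ⟨hp, hpU⟩
      rw [mem_holTangentSpace_siegel hι hF]
      simpa [liftField] using hXM _ ⟨(mem_siegel_iff hι hF).1 hp, hpU⟩
  | bracket X₁ X₂ h₁ h₂ ih₁ ih₂ =>
    obtain ⟨Y₁, hY₁, he₁⟩ := ih₁
    obtain ⟨Y₂, hY₂, he₂⟩ := ih₂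
    refine ⟨_, .bracket Y₁ Y₂ hY₁ hY₂, fun p hp => ?_⟩
    rw [(he₁.eventuallyEq_of_mem (hU'.mem_nhds hp)).lieBracket_vectorField_eq
      (he₂.eventuallyEq_of_mem (hU'.mem_nhds hp))]
    have hd : ∀ {X}, IsIteratedBracket (tube hι C) U X → DifferentiableAt ℝ X (shift F p) :=
      fun h => ((h.contDiffOn hU).contDiffAt (hU.mem_nhds hp)).differentiableAt (by simp)
    exact lieBracket_liftField F (hd h₁) (hd h₂)

/-- The horizontal vector field on the Siegel submanifold defined by `u ∈ W`. -/
noncomputable def horizontalField (F : W →ₗ[ℂ] W →ₗ⋆[ℂ] VC) (u : W) (p : VC × W) : VC × W :=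
  ((2 * Complex.I) • F u p.2, u)

theorem hasFDerivAt_horizontalField (F : W →ₗ[ℂ] W →ₗ⋆[ℂ] VC) (u : W) (p : VC × W) :
    HasFDerivAt (horizontalField F u)
      ((((2 * Complex.I) • (realForm F u).comp (ContinuousLinearMap.snd ℝ VC W))).prod
        (0 : VC × W →L[ℝ] W)) p :=
  (((2 * Complex.I) • (realForm F u).comp (ContinuousLinearMap.snd ℝ VC W)).hasFDerivAt).prodMk
    (hasFDerivAt_const _ _)

theorem isIteratedBracket_horizontalField (hι : IsBaseChange ℂ ι) {F : W →ₗ[ℂ] W →ₗ⋆[ℂ] VC}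
    (hF : IsVHermitian ι F) (C : Set V) (U : Set (VC × W)) (u : W) :
    IsIteratedBracket (siegel hι F C) U (horizontalField F u) := by
  refine .sec _ ?_ ?_
  · have h : ContDiff ℝ ∞ fun p : VC × W => realForm F u p.2 :=
      (realForm F u).contDiff.comp contDiff_snd
    exact ((h.const_smul (2 * Complex.I)).prodMk contDiff_const).contDiffOn
  · rintro p ⟨hp, -⟩
    have h0 := zero_mem_tangentSpace ((mem_siegel_iff hι hF).1 hp)
    rw [mem_holTangentSpace_siegel hι hF, mem_holTangentSpace_iff]
    simpa [horizontalField] using h0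

theorem lieBracket_horizontalField (F : W →ₗ[ℂ] W →ₗ⋆[ℂ] VC) (u u' : W) (p : VC × W) :
    VectorField.lieBracket ℝ (horizontalField F u) (horizontalField F u') p =
      ((2 * Complex.I) • (F u' u - F u u'), 0) := by
  simp [VectorField.lieBracket, (hasFDerivAt_horizontalField F _ p).fderiv, horizontalField,
    smul_sub]

/-- Brackets of horizontal fields give the real directions if `F(W, W)` spans. -/
theorem inclusion_mem_span_isIteratedBracket (hι : IsBaseChange ℂ ι)
    {F : W →ₗ[ℂ] W →ₗ⋆[ℂ] VC} (hF : IsVHermitian ι F) (C : Set V) (U : Set (VC × W))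
    (hspan : Submodule.span ℂ {v : VC | ∃ w w' : W, v = F w w'} = ⊤) (p : VC × W) (z : VC) :
    ((ι (imPart hι z), 0) : VC × W) ∈
      Submodule.span ℝ {v | ∃ X, IsIteratedBracket (siegel hι F C) U X ∧ v = X p} := by
  have hform : ∀ u u' : W, ((ι (imPart hι (F u u')), 0) : VC × W) ∈
      Submodule.span ℝ {v | ∃ X, IsIteratedBracket (siegel hι F C) U X ∧ v = X p} := by
    intro u u'
    have h1 := (IsIteratedBracket.bracket _ _ (isIteratedBracket_horizontalField hι hF C U u)
      (isIteratedBracket_horizontalField hι hF C U u')).apply_mem_span p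
    rw [lieBracket_horizontalField] at h1
    -- The bracket is `2i(F(u', u) - F(u, u')) = 4 Im F(u, u')`, whence the factor `1/4`.
    have h2 := Submodule.smul_mem _ ((4 : ℝ)⁻¹) h1
    convert h2 using 1
    have e1 := re_add_im hι (F u u')
    have e2 := re_add_im hι (F u' u)
    rw [imPart_form_swap hι hF u u', imPart_I_smul_form_swap hι hF u u'] at e2
    have e3 : F u' u - F u u' = -((2 * Complex.I) • ι (imPart hι (F u u'))) :=
      (congrArg₂ (· - ·) e2 e1).trans (by simp only [map_neg]; module)
    rw [e3, Prod.smul_mk, smul_zero, smul_neg, smul_smul,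
      show (2 * Complex.I) * (2 * Complex.I) = -4 by
        linear_combination 4 * Complex.I_mul_I]
    congr 1
    rw [neg_smul, neg_neg, ← Complex.coe_smul, smul_smul]
    norm_num
  have hz : z ∈ Submodule.span ℂ {v : VC | ∃ w w' : W, v = F w w'} := by
    rw [hspan]
    trivial
  -- Since `c F(w, w') = F(cw, w')`, the complex span consists of sums of values of `F`, and `Im` is
  -- additive.
  induction hz using Submodule.closure_induction with
  | zero =>
    rw [map_zero, map_zero, Prod.mk_zero_zero]
    exact Submodule.zero_mem _
  | add x y _ _ hx hy =>
    have := Submodule.add_mem _ hx hy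
    simpa using this
  | smul_mem c x hx =>
    obtain ⟨w, w', rfl⟩ := hx
    have := hform (c • w) w'
    simpa using this

/-- Subtracting the horizontal field of `v.2` from a tangent vector `v` leaves a vector with zero
`W`-component. -/
theorem finiteTypeAt_siegel_of_forall (hι : IsBaseChange ℂ ι) {F : W →ₗ[ℂ] W →ₗ⋆[ℂ] VC}
    (hF : IsVHermitian ι F) {C : Set V} {a : VC × W} {U : Set (VC × W)} (hU : IsOpen U)
    (ha : a ∈ U) (h : ∀ v ∈ tangentSpace (tube hι C) (shift F a), ((v, 0) : VC × W) ∈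
      Submodule.span ℝ {v | ∃ X, IsIteratedBracket (siegel hι F C) U X ∧ v = X a}) :
    FiniteTypeAt (siegel hι F C) a := by
  refine ⟨U, hU, ha, fun v hv => ?_⟩
  have h1 := h _ ((mem_tangentSpace_siegel hι hF).1 hv)
  have h2 := (isIteratedBracket_horizontalField hι hF C U v.2).apply_mem_span a
  have h3 := Submodule.add_mem _ h1 h2
  simpa [horizontalField] using h3

theorem finiteType_siegel_of_finiteType_tube (hι : IsBaseChange ℂ ι)
    {F : W →ₗ[ℂ] W →ₗ⋆[ℂ] VC} (hF : IsVHermitian ι F) {C : Set V}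
    (hT : FiniteType (tube hι C)) : FiniteType (siegel hι F C) := by
  intro a ha
  obtain ⟨U, hU, haU, hspan⟩ := hT _ ((mem_siegel_iff hι hF).1 ha)
  refine finiteTypeAt_siegel_of_forall hι hF (U := shift F ⁻¹' U)
    (hU.preimage (contDiff_shift F).continuous) haU fun v hv => ?_
  have hv' := Submodule.mem_map_of_mem (f := LinearMap.inl ℝ VC W) (hspan hv)
  rw [Submodule.map_span] at hv'
  refine Submodule.span_mono ?_ hv'
  rintro _ ⟨_, ⟨X, hX, rfl⟩, rfl⟩
  obtain ⟨Y, hY, hYX⟩ := exists_isIteratedBracket_lift hι hF hU hX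
  exact ⟨Y, hY, (hYX haU).symm⟩

theorem finiteType_siegel_of_span_eq_top [FiniteDimensional ℝ V] (hι : IsBaseChange ℂ ι)
    {F : W →ₗ[ℂ] W →ₗ⋆[ℂ] VC} (hF : IsVHermitian ι F) {C : Set V} (hC : IsAnalyticSubmanifold C)
    (hspan : Submodule.span ℂ {v : VC | ∃ w w' : W, v = F w w'} = ⊤) :
    FiniteType (siegel hι F C) := by
  intro a ha
  obtain ⟨U, hU, haU, hX⟩ := exists_isIteratedBracket_tube hι hC ((mem_siegel_iff hι hF).1 ha)
  refine finiteTypeAt_siegel_of_forall hι hF (U := shift F ⁻¹' U)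
    (hU.preimage (contDiff_shift F).continuous) haU fun v hv => ?_
  obtain ⟨X, hX, hXv⟩ := hX v hv
  obtain ⟨Y, hY, hYX⟩ := exists_isIteratedBracket_lift hι hF hU hX
  -- The imaginary part of `iv` is the real part of `v`; `h2` supplies the imaginary part of `v`.
  have h1 := inclusion_mem_span_isIteratedBracket hι hF C (shift F ⁻¹' U) hspan a (Complex.I • v)
  have h2 := hY.apply_mem_span a
  rw [hYX haU, liftField, hXv] at h2
  have h3 := Submodule.add_mem _ h1 h2
  rwa [Prod.mk_add_mk, add_zero, ← re_add_im hι v] at h3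

end FiniteType

end SiegelCR

theorem mainTheorem10 {V VC W : Type*}
    [NormedAddCommGroup V] [NormedSpace ℝ V] [FiniteDimensional ℝ V]
    [NormedAddCommGroup VC] [NormedSpace ℂ VC]
    [NormedAddCommGroup W] [NormedSpace ℂ W] [FiniteDimensional ℂ W]
    (ι : V →ₗ[ℝ] VC) (hι : IsBaseChange ℂ ι)
    (F : W →ₗ[ℂ] W →ₗ⋆[ℂ] VC)
    (hF : SiegelCR.IsVHermitian ι F) (hFnd : SiegelCR.IsNondegenerate F)
    (C : Set V) (hC : SiegelCR.IsAnalyticSubmanifold C) :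
    (SiegelCR.HolNondegenerate (SiegelCR.tube hι C) →
      SiegelCR.HolNondegenerate (SiegelCR.siegel hι F C)) ∧
    ((SiegelCR.FiniteType (SiegelCR.tube hι C) ∨
        Submodule.span ℂ {v : VC | ∃ w w' : W, v = F w w'} = ⊤) →
      SiegelCR.FiniteType (SiegelCR.siegel hι F C)) := by
  refine ⟨SiegelCR.holNondegenerate_siegel hι hF hFnd, ?_⟩
  rintro (hT | hspan)
  · exact SiegelCR.finiteType_siegel_of_finiteType_tube hι hF hT
  · exact SiegelCR.finiteType_siegel_of_span_eq_top hι hF hC hspan
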